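/- A continuum is a nonempty compact connected metric space; it is nondegenerate if it has more than one point. A continuum $X$ is Suslinian if every family of pairwise disjoint nondegenerate subcontinua of $X$ is countable. A continuous action of a (discrete) group $G$ on a compact metric space $(X,d)$ is a group homomorphism $\phi\colon G\to \mathrm{Homeo}(X)$; it is expansive if there is $c>0$ such that $\sup_{g\in G} d(\phi(g)x,\phi(g)y)>c$ for all distinct $x,y\in X$. Let $G$ be a finitely generated nilpotent group and let $X$ be a nondegenerate Suslinian continuum. Then no continuous action of $G$ on $X$ is expansive. -/

import Mathlib

/-- A subcontinuum of a metric space: a nonempty compact connected subset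
(`IsConnected` includes nonemptiness). -/
def IsSubcontinuum {X : Type*} [MetricSpace X] (K : Set X) : Prop :=
  IsCompact K ∧ IsConnected K

/-- `X` is Suslinian: every family of pairwise disjoint nondegenerate subcontinua of `X`
is countable. -/
def IsSuslinian (X : Type*) [MetricSpace X] : Prop :=
  ∀ 𝒦 : Set (Set X), (∀ K ∈ 𝒦, IsSubcontinuum K ∧ K.Nontrivial) →
    𝒦.PairwiseDisjoint id → 𝒦.Countable

/-- A continuous action `φ : G → Homeo(X)` of a (discrete) group `G` on a compact metric space
is expansive if there is `c > 0` with `sup_{g ∈ G} d(gx, gy) > c` for all distinct `x, y`.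
The supremum is that of a nonempty bounded set of reals, because `X` is compact. -/
def IsExpansive {G X : Type*} [Group G] [MetricSpace X] [CompactSpace X]
    (φ : G →* (X ≃ₜ X)) : Prop :=
  ∃ c : ℝ, 0 < c ∧ ∀ x y : X, x ≠ y → c < ⨆ g : G, dist (φ g x) (φ g y)

/-!
Suppose that the action is expansive with constant `c`. A continuum of diameter at least `c`
contains, by boundary bumping, two continua of diameter at least `c / 3` at distance at least
`c / 3` from each other, and by compactness each of them is expanded to diameter at least `c` by
an element of a fixed finite set `F ⊆ G`. Iterating, every `A` in the hyperspace of continua of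
diameter at least `c` carries binary trees of continua: the nodes at depth `n` are `2 ^ n`
continua of diameter at least `c`, with pairwise disjoint preimages in `A` under elements of
`F ^ n`. Having such trees is a closed condition (`isClosed_splitting`), so by Zorn's lemma there
is a minimal nonempty closed family `P` that is closed under a choice of trees
(`exists_minimal_isBranching`).

Since `X` is Suslinian, a Cantor scheme shows that some nonempty relatively open part `P ∩ U`
consists of pairwise intersecting continua (`IsSuslinian.exists_isOpen_pairwise_inter`). By
minimality, trees in `P` cannot avoid `U` below some fixed depth `k`
(`exists_avoidingTree_eq_empty`). Hence a member of `P` contains `2 ^ j` pairwise disjoint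
continua that are taken to members of `P ∩ U` by elements of `F ^ (j + k)`
(`exists_disjoint_preimages`). Finite subsets of nilpotent groups have polynomial growth
(`hasPolynomialGrowth_of_isNilpotent`), so for large `j` one and the same group element takes two
disjoint continua to members of `P ∩ U`; the images are disjoint, a contradiction.
-/

/-! ### Polynomial growth in nilpotent groups -/

open scoped Pointwise in
/-- The finite set `S` has polynomial growth: the number of elements of the group that are products
of `n` elements of `S` is bounded by a fixed power of `n + 1`. -/
def HasPolynomialGrowth {G : Type*} [Group G] [DecidableEq G] (S : Finset G) : Prop :=
  ∃ d : ℕ, ∀ n : ℕ, (S ^ n).card ≤ (n + 1) ^ d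

section Growth

open scoped Pointwise commutatorElement

variable {G : Type*} [Group G]

lemma iterate_commutator_mem_upperCentralSeries (a : G) {k : ℕ} :
    ∀ j, ∀ t ∈ Subgroup.upperCentralSeries G (k + j),
      (fun s ↦ ⁅a, s⁆)^[j] t ∈ Subgroup.upperCentralSeries G k := by
  intro j
  induction j with
  | zero => intro t ht; exact ht
  | succ j ih =>
    intro t ht
    refine ih _ ?_
    have := inv_mem (Subgroup.mem_upperCentralSeries_succ_iff.1 ht a)
    rwa [commutatorElement_inv] at this

variable [DecidableEq G]

lemma HasPolynomialGrowth.mono {S T : Finset G} (hT : HasPolynomialGrowth T) (h : S ⊆ T) :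
    HasPolynomialGrowth S := by
  obtain ⟨d, hd⟩ := hT
  exact ⟨d, fun n ↦ (Finset.card_le_card (Finset.pow_subset_pow_left h)).trans (hd n)⟩

/-- If `T` is closed under `t ↦ ⁅a, t⁆` and `m` such steps take `t` to `1`, then conjugating `t`
by `a ^ e` gives a word in `T` whose length is polynomial in `e`. -/
lemma conj_pow_mem_pow {T : Finset G} (h1 : 1 ∈ T) {a : G} (hT : ∀ t ∈ T, ⁅a, t⁆ ∈ T) (m : ℕ) :
    ∀ t ∈ T, (fun s ↦ ⁅a, s⁆)^[m] t = 1 → ∀ e : ℕ, a ^ e * t * (a ^ e)⁻¹ ∈ T ^ ((e + 1) ^ m) := by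
  induction m with
  | zero =>
    intro t ht h e
    obtain rfl : t = 1 := h
    simpa using h1
  | succ m ih =>
    intro t ht h e
    have key : a ^ e * t * (a ^ e)⁻¹ ∈ T ^ (1 + e * (e + 1) ^ m) := by
      induction e with
      | zero => simpa using ht
      | succ e ihe =>
        -- `a t a⁻¹ = ⁅a, t⁆ t`, and the induction on `m` applies to `⁅a, t⁆`.
        have hsplit : a ^ (e + 1) * t * (a ^ (e + 1))⁻¹ =
            (a ^ e * ⁅a, t⁆ * (a ^ e)⁻¹) * (a ^ e * t * (a ^ e)⁻¹) := by
          rw [commutatorElement_def, pow_succ]; group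
        rw [hsplit]
        have hmul := Finset.mul_mem_mul (ih ⁅a, t⁆ (hT t ht) h e) ihe
        rw [← pow_add] at hmul
        refine Finset.pow_subset_pow_right h1 ?_ hmul
        have hle : (e + 1) ^ m ≤ (e + 1 + 1) ^ m := Nat.pow_le_pow_left (by omega) m
        nlinarith
    refine Finset.pow_subset_pow_right h1 ?_ key
    have : 1 ≤ (e + 1) ^ m := Nat.one_le_pow _ _ (by omega)
    rw [pow_succ]
    nlinarith

/-- A word in `T` and `a` becomes, after collecting the letters `a` on the right, a polynomially
longer word in `T` followed by a power of `a`. -/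
lemma exists_eq_mul_pow_of_mem_insert_pow {T : Finset G} (h1 : 1 ∈ T) {a : G}
    (hT : ∀ t ∈ T, ⁅a, t⁆ ∈ T) {m : ℕ} (hm : ∀ t ∈ T, (fun s ↦ ⁅a, s⁆)^[m] t = 1) (N : ℕ) :
    ∀ n ≤ N, ∀ w ∈ (insert a T) ^ n, ∃ e ≤ n, ∃ v ∈ T ^ (n * (N + 1) ^ m), w = v * a ^ e := by
  intro n
  induction n with
  | zero =>
    intro _ w hw
    exact ⟨0, le_rfl, 1, by simp, by simpa using hw⟩
  | succ n ih =>
    intro hn w hw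
    rw [pow_succ, Finset.mem_mul] at hw
    obtain ⟨w', hw', x, hx, rfl⟩ := hw
    obtain ⟨e, he, v, hv, rfl⟩ := ih (by omega) w' hw'
    rcases Finset.mem_insert.1 hx with rfl | hx
    · refine ⟨e + 1, by omega, v, ?_, by rw [pow_succ, mul_assoc]⟩
      exact Finset.pow_subset_pow_right h1 (Nat.mul_le_mul_right _ n.le_succ) hv
    · refine ⟨e, by omega, v * (a ^ e * x * (a ^ e)⁻¹), ?_, by group⟩
      have hc := Finset.pow_subset_pow_right h1
        (Nat.pow_le_pow_left (show e + 1 ≤ N + 1 by omega) m)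
        (conj_pow_mem_pow h1 hT m x hx (hm x hx) e)
      have := Finset.mul_mem_mul hv hc
      rwa [← pow_add, ← Nat.succ_mul] at this

lemma HasPolynomialGrowth.insert {T : Finset G} (hgr : HasPolynomialGrowth T) (h1 : 1 ∈ T) {a : G}
    (hT : ∀ t ∈ T, ⁅a, t⁆ ∈ T) {m : ℕ} (hm : ∀ t ∈ T, (fun s ↦ ⁅a, s⁆)^[m] t = 1) :
    HasPolynomialGrowth (insert a T) := by
  obtain ⟨d, hd⟩ := hgr
  refine ⟨(m + 1) * d + 1, fun n ↦ ?_⟩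
  have hsub : (Insert.insert a T : Finset G) ^ n ⊆
      ((T ^ (n * (n + 1) ^ m)) ×ˢ Finset.range (n + 1)).image fun p ↦ p.1 * a ^ p.2 := by
    intro w hw
    obtain ⟨e, he, v, hv, rfl⟩ :=
      exists_eq_mul_pow_of_mem_insert_pow h1 hT hm n n le_rfl w hw
    exact Finset.mem_image.2
      ⟨(v, e), Finset.mem_product.2 ⟨hv, Finset.mem_range.2 (by omega)⟩, rfl⟩
  have hlen : n * (n + 1) ^ m + 1 ≤ (n + 1) ^ (m + 1) := by
    have : 1 ≤ (n + 1) ^ m := Nat.one_le_pow _ _ (by omega)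
    rw [pow_succ]
    nlinarith
  calc ((Insert.insert a T : Finset G) ^ n).card
      ≤ (T ^ (n * (n + 1) ^ m)).card * (n + 1) := by
        refine (Finset.card_le_card hsub).trans (Finset.card_image_le.trans ?_)
        rw [Finset.card_product, Finset.card_range]
    _ ≤ ((n + 1) ^ (m + 1)) ^ d * (n + 1) :=
        Nat.mul_le_mul_right _ ((hd _).trans (Nat.pow_le_pow_left hlen d))
    _ = (n + 1) ^ ((m + 1) * d + 1) := by rw [← pow_mul, pow_succ]

/-- Finite subsets of nilpotent groups have polynomial growth. The induction runs up the upper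
central series `Z k`: elements of `Z (k + 1)` are added one at a time to a finite subset of
`Z k`, which is first enlarged by the commutators that collecting the new element creates. -/
theorem hasPolynomialGrowth_of_subset_upperCentralSeries (k : ℕ) :
    ∀ S : Finset G, (∀ s ∈ S, s ∈ Subgroup.upperCentralSeries G k) → HasPolynomialGrowth S := by
  induction k with
  | zero =>
    intro S hS
    refine HasPolynomialGrowth.mono (T := {1}) ⟨0, fun n ↦ by simp⟩ fun s hs ↦ ?_
    simpa [Subgroup.mem_bot] using hS s hs
  | succ k ih =>
    suffices H : ∀ R : Finset G, (∀ s ∈ R, s ∈ Subgroup.upperCentralSeries G (k + 1)) →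
        ∀ S : Finset G, (∀ s ∈ S, s ∈ Subgroup.upperCentralSeries G k) → 1 ∈ S →
          HasPolynomialGrowth (R ∪ S) by
      intro R hR
      exact (H R hR {1} (by simp [one_mem]) (by simp)).mono Finset.subset_union_left
    intro R
    induction R using Finset.induction_on with
    | empty => intro _ S hS _; simpa using ih S hS
    | insert a R _ ihR =>
      intro hR S hS h1
      have hRk : ∀ s ∈ R ∪ S, s ∈ Subgroup.upperCentralSeries G (k + 1) := by
        intro s hs
        rcases Finset.mem_union.1 hs with hs | hs
        · exact hR s (Finset.mem_insert_of_mem hs)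
        · exact Subgroup.upperCentralSeries_mono G k.le_succ (hS s hs)
      have hvanish : ∀ t ∈ Subgroup.upperCentralSeries G (k + 1),
          (fun s ↦ ⁅a, s⁆)^[k + 1] t = 1 := by
        intro t ht
        have := iterate_commutator_mem_upperCentralSeries a (k := 0) (k + 1) t (by simpa using ht)
        simpa [Subgroup.mem_bot] using this
      set S' : Finset G := S ∪ ((R ∪ S) ×ˢ Finset.range (k + 1)).image
        fun p ↦ (fun s ↦ ⁅a, s⁆)^[p.2 + 1] p.1 with hS'
      have hcomm : ∀ t ∈ Subgroup.upperCentralSeries G (k + 1),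
          ⁅a, t⁆ ∈ Subgroup.upperCentralSeries G k :=
        fun t ht ↦ iterate_commutator_mem_upperCentralSeries a 1 t ht
      have hiter : ∀ j, ∀ t ∈ Subgroup.upperCentralSeries G (k + 1),
          (fun s ↦ ⁅a, s⁆)^[j + 1] t ∈ Subgroup.upperCentralSeries G k := by
        intro j
        induction j with
        | zero => exact hcomm
        | succ j ihj =>
          intro t ht
          exact ihj _ (Subgroup.upperCentralSeries_mono G k.le_succ (hcomm t ht))
      have hS'k : ∀ s ∈ S', s ∈ Subgroup.upperCentralSeries G k := by
        intro s hs
        rcases Finset.mem_union.1 hs with hs | hs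
        · exact hS s hs
        · obtain ⟨⟨t, j⟩, hp, rfl⟩ := Finset.mem_image.1 hs
          exact hiter j t (hRk t (Finset.mem_product.1 hp).1)
      have h1' : (1 : G) ∈ S' := Finset.mem_union_left _ h1
      have hclosed : ∀ t ∈ R ∪ S', ⁅a, t⁆ ∈ R ∪ S' := by
        have hbase : ∀ t ∈ R ∪ S, ⁅a, t⁆ ∈ R ∪ S' := fun t ht ↦
          Finset.mem_union_right _ <| Finset.mem_union_right _ <| Finset.mem_image.2
            ⟨(t, 0), Finset.mem_product.2 ⟨ht, Finset.mem_range.2 k.succ_pos⟩, rfl⟩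
        intro t ht
        rcases Finset.mem_union.1 ht with ht | ht
        · exact hbase t (Finset.mem_union_left _ ht)
        rcases Finset.mem_union.1 ht with ht | ht
        · exact hbase t (Finset.mem_union_right _ ht)
        obtain ⟨⟨r, j⟩, hp, rfl⟩ := Finset.mem_image.1 ht
        obtain ⟨hr, hj⟩ := Finset.mem_product.1 hp
        change r ∈ R ∪ S at hr
        have hj' : j < k + 1 := Finset.mem_range.1 hj
        change ⁅a, (fun s ↦ ⁅a, s⁆)^[j + 1] r⁆ ∈ R ∪ S'
        rcases Nat.lt_or_ge (j + 1) (k + 1) with hlt | hge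
        · refine Finset.mem_union_right _ <| Finset.mem_union_right _ <| Finset.mem_image.2
            ⟨(r, j + 1), Finset.mem_product.2 ⟨hr, Finset.mem_range.2 hlt⟩, ?_⟩
          exact Function.iterate_succ_apply' _ _ _
        · obtain rfl : j = k := by omega
          rw [hvanish r (hRk r hr), commutatorElement_one_right]
          exact Finset.mem_union_right _ h1'
      have hmem : ∀ t ∈ R ∪ S', (fun s ↦ ⁅a, s⁆)^[k + 1] t = 1 := by
        intro t ht
        refine hvanish t ?_
        rcases Finset.mem_union.1 ht with ht | ht
        · exact hRk t (Finset.mem_union_left _ ht)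
        · exact Subgroup.upperCentralSeries_mono G k.le_succ (hS'k t ht)
      have hgr : HasPolynomialGrowth (R ∪ S') :=
        ihR (fun s hs ↦ hR s (Finset.mem_insert_of_mem hs)) S' hS'k h1'
      refine (hgr.insert (Finset.mem_union_right _ h1') hclosed hmem).mono ?_
      rw [Finset.insert_union]
      exact Finset.insert_subset_insert _
        (Finset.union_subset_union_right Finset.subset_union_left)

theorem hasPolynomialGrowth_of_isNilpotent [Group.IsNilpotent G] (S : Finset G) :
    HasPolynomialGrowth S := by
  obtain ⟨n, hn⟩ := Group.IsNilpotent.nilpotent G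
  exact hasPolynomialGrowth_of_subset_upperCentralSeries n S fun s _ ↦ hn ▸ Subgroup.mem_top s

/-- Exponential beats polynomial growth, with an offset `k` in the word length. -/
lemma HasPolynomialGrowth.exists_card_pow_lt_two_pow {S : Finset G} (hS : HasPolynomialGrowth S)
    (k : ℕ) : ∃ j : ℕ, (S ^ (j + k)).card < 2 ^ j := by
  obtain ⟨d, hd⟩ := hS
  have hlim := tendsto_pow_const_div_const_pow_of_one_lt d (one_lt_two (α := ℝ))
  have hpos : (0 : ℝ) < ((2 : ℝ) ^ (k + 1))⁻¹ := by positivity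
  obtain ⟨N, hN⟩ := Filter.eventually_atTop.1 (hlim.eventually (gt_mem_nhds hpos))
  refine ⟨N, (hd _).trans_lt ?_⟩
  have h := hN (N + k + 1) (by omega)
  rw [div_lt_iff₀ (by positivity), inv_mul_eq_div, lt_div_iff₀ (by positivity),
    show N + k + 1 = N + (k + 1) by ring, pow_add _ N, mul_lt_mul_iff_left₀ (by positivity)] at h
  have h' : ((N + k + 1 : ℕ) : ℝ) ^ d < 2 ^ N := h
  exact_mod_cast h'

end Growth

open Set TopologicalSpace Filter Topology

/-! ### Cantor schemes and branching relations in compact spaces -/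

section CompactSpaces

variable {Y : Type*} [TopologicalSpace Y] [CompactSpace Y]

/-- Cantor scheme: if `D` is open and every relatively open nonempty part of the closed set `P`
contains a pair from `D`, then `P` contains a family indexed by `ℕ → Bool` any two members of
which form, in one of the two orders, a pair from `D`. -/
lemma exists_cantor_family [RegularSpace Y] {P : Set Y} (hP : IsClosed P) (hne : P.Nonempty)
    {D : Set (Y × Y)} (hD : IsOpen D)
    (h : ∀ U, IsOpen U → (P ∩ U).Nonempty → ∃ A ∈ P ∩ U, ∃ B ∈ P ∩ U, (A, B) ∈ D) :
    ∃ f : (ℕ → Bool) → Y, (∀ x, f x ∈ P) ∧ ∀ x y, x ≠ y → (f x, f y) ∈ D ∨ (f y, f x) ∈ D := by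
  let N := {C : Set Y // IsClosed C ∧ (P ∩ interior C).Nonempty}
  have hsplit : ∀ C : N, ∃ s : Bool → N, (∀ b, (s b).1 ⊆ C.1) ∧
      (s false).1 ×ˢ (s true).1 ⊆ D := by
    rintro ⟨C, hC, hCP⟩
    obtain ⟨A, ⟨hAP, hAC⟩, B, ⟨hBP, hBC⟩, hAB⟩ := h _ isOpen_interior hCP
    obtain ⟨V, hV, W, hW, hVW⟩ := mem_nhds_prod_iff.1 (hD.mem_nhds hAB)
    obtain ⟨V', hV', hV'c, hV's⟩ := exists_mem_nhds_isClosed_subset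
      (inter_mem hV (isOpen_interior.mem_nhds hAC))
    obtain ⟨W', hW', hW'c, hW's⟩ := exists_mem_nhds_isClosed_subset
      (inter_mem hW (isOpen_interior.mem_nhds hBC))
    refine ⟨fun b ↦ bif b then ⟨W', hW'c, B, hBP, mem_interior_iff_mem_nhds.2 hW'⟩
      else ⟨V', hV'c, A, hAP, mem_interior_iff_mem_nhds.2 hV'⟩, ?_, ?_⟩
    · rintro (_ | _)
      · exact hV's.trans (inter_subset_right.trans interior_subset)
      · exact hW's.trans (inter_subset_right.trans interior_subset)
    · exact (prod_mono (hV's.trans inter_subset_left) (hW's.trans inter_subset_left)).trans hVW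
  choose s hs hsD using hsplit
  let root : N := ⟨univ, isClosed_univ, by simpa using hne⟩
  let node : (ℕ → Bool) → ℕ → N := fun x n ↦ Nat.rec root (fun n C ↦ s C (x n)) n
  have hsucc : ∀ x n, node x (n + 1) = s (node x n) (x n) := fun _ _ ↦ rfl
  have hpoint : ∀ x, (⋂ n, P ∩ (node x n).1).Nonempty := by
    intro x
    refine IsCompact.nonempty_iInter_of_sequence_nonempty_isCompact_isClosed _
      (fun n ↦ inter_subset_inter_right _ (hs _ _))
      (fun n ↦ (node x n).2.2.mono (inter_subset_inter_right _ interior_subset))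
      (hP.inter (node x 0).2.1).isCompact (fun n ↦ hP.inter (node x n).2.1)
  choose f hf using hpoint
  simp only [mem_iInter, mem_inter_iff] at hf
  refine ⟨f, fun x ↦ (hf x 0).1, fun x y hxy ↦ ?_⟩
  have hdiff : ∃ n, x n ≠ y n := Function.ne_iff.1 hxy
  classical
  let n := Nat.find hdiff
  have hagree : ∀ m ≤ n, node x m = node y m := by
    intro m
    induction m with
    | zero => intro _; rfl
    | succ m ih =>
      intro hm
      rw [hsucc, hsucc, ih (by omega), not_not.1 (Nat.find_min hdiff (show m < n by omega))]
  have hx := (hf x (n + 1)).2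
  have hy := (hf y (n + 1)).2
  rw [hsucc] at hx hy
  rw [hagree n le_rfl] at hx
  have hn : x n ≠ y n := Nat.find_spec hdiff
  cases hxn : x n <;> cases hyn : y n <;> rw [hxn] at hx <;> rw [hyn] at hy
  · exact absurd (hxn.trans hyn.symm) hn
  · exact Or.inl (hsD _ ⟨hx, hy⟩)
  · exact Or.inr (hsD _ ⟨hy, hx⟩)
  · exact absurd (hxn.trans hyn.symm) hn

/-- `P` is branching for the ternary relation `R` if every `A ∈ P` has, within `P`, two
descendants `B` and `C` with `(A, B, C) ∈ R`; so `P` contains binary trees starting anywhere. -/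
def IsBranching (R : Set (Y × Y × Y)) (P : Set Y) : Prop :=
  ∀ A ∈ P, ∃ B ∈ P, ∃ C ∈ P, (A, B, C) ∈ R

/-- By compactness, descendants in each of a directed family of closed sets can be replaced by
descendants in the intersection. -/
lemma exists_mem_iInter_of_directed {R : Set (Y × Y × Y)} (hR : IsClosed R) {ι : Type*}
    [Nonempty ι] {t : ι → Set Y} (hd : Directed (· ⊇ ·) t) (ht : ∀ i, IsClosed (t i)) {A : Y}
    (h : ∀ i, ∃ B ∈ t i, ∃ C ∈ t i, (A, B, C) ∈ R) :
    ∃ B ∈ ⋂ i, t i, ∃ C ∈ ⋂ i, t i, (A, B, C) ∈ R := by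
  have hcl : ∀ i, IsClosed {q : Y × Y | q ∈ t i ×ˢ t i ∧ (A, q) ∈ R} := fun i ↦
    ((ht i).prod (ht i)).inter (hR.preimage (by fun_prop : Continuous fun q : Y × Y ↦ (A, q)))
  obtain ⟨q, hq⟩ := IsCompact.nonempty_iInter_of_directed_nonempty_isCompact_isClosed
    (fun i ↦ {q : Y × Y | q ∈ t i ×ˢ t i ∧ (A, q) ∈ R})
    (fun i j ↦ by
      obtain ⟨k, hki, hkj⟩ := hd i j
      exact ⟨k, fun q hq ↦ ⟨prod_mono hki hki hq.1, hq.2⟩,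
        fun q hq ↦ ⟨prod_mono hkj hkj hq.1, hq.2⟩⟩)
    (fun i ↦ by
      obtain ⟨B, hB, C, hC, hBC⟩ := h i
      exact ⟨(B, C), ⟨hB, hC⟩, hBC⟩)
    (fun i ↦ (hcl i).isCompact) hcl
  simp only [mem_iInter] at hq
  exact ⟨q.1, mem_iInter.2 fun i ↦ (hq i).1.1, q.2, mem_iInter.2 fun i ↦ (hq i).1.2,
    (hq (Classical.arbitrary ι)).2⟩

lemma exists_minimal_isBranching {R : Set (Y × Y × Y)} (hR : IsClosed R) {P : Set Y}
    (hP : IsClosed P) (hne : P.Nonempty) (hb : IsBranching R P) :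
    ∃ Q ⊆ P, Minimal (fun Q ↦ IsClosed Q ∧ Q.Nonempty ∧ IsBranching R Q) Q := by
  refine zorn_superset_nonempty {Q : Set Y | IsClosed Q ∧ Q.Nonempty ∧ IsBranching R Q} ?_ P
    ⟨hP, hne, hb⟩
  intro c hc hchain hcne
  have : Nonempty c := hcne.to_subtype
  have hdir : DirectedOn (· ⊇ ·) c := fun Q hQ Q' hQ' ↦
    (hchain.total hQ hQ').elim (fun h ↦ ⟨Q, hQ, subset_rfl, h⟩) fun h ↦ ⟨Q', hQ', h, subset_rfl⟩
  refine ⟨⋂₀ c, ⟨isClosed_sInter fun Q hQ ↦ (hc hQ).1, ?_, ?_⟩, fun Q hQ ↦ sInter_subset_of_mem hQ⟩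
  · exact IsCompact.nonempty_sInter_of_directed_nonempty_isCompact_isClosed hdir
      (fun Q hQ ↦ (hc hQ).2.1) (fun Q hQ ↦ (hc hQ).1.isCompact) (fun Q hQ ↦ (hc hQ).1)
  · intro A hA
    rw [sInter_eq_iInter] at hA ⊢
    rw [mem_iInter] at hA
    exact exists_mem_iInter_of_directed hR hdir.directed_val (fun Q ↦ (hc Q.2).1)
      fun Q ↦ (hc Q.2).2.2 A (hA Q)

/-- The points of `P` from which some binary tree of depth `k` in `P` avoids `U`. -/
def avoidingTree (R : Set (Y × Y × Y)) (P U : Set Y) : ℕ → Set Y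
  | 0 => P \ U
  | k + 1 => {A ∈ avoidingTree R P U k |
      ∃ B ∈ avoidingTree R P U k, ∃ C ∈ avoidingTree R P U k, (A, B, C) ∈ R}

lemma isClosed_avoidingTree [T2Space Y] {R : Set (Y × Y × Y)} (hR : IsClosed R) {P U : Set Y}
    (hP : IsClosed P) (hU : IsOpen U) (k : ℕ) : IsClosed (avoidingTree R P U k) := by
  induction k with
  | zero => exact hP.sdiff hU
  | succ k ih =>
    have hcl : IsClosed (Prod.fst '' (R ∩ univ ×ˢ avoidingTree R P U k ×ˢ avoidingTree R P U k)) :=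
      ((hR.inter (isClosed_univ.prod (ih.prod ih))).isCompact.image continuous_fst).isClosed
    convert ih.inter hcl using 2
    ext A
    refine and_congr_right fun _ ↦ ⟨?_, ?_⟩
    · rintro ⟨B, hB, C, hC, hBC⟩
      exact ⟨(A, B, C), ⟨hBC, mem_univ _, hB, hC⟩, rfl⟩
    · rintro ⟨⟨A, B, C⟩, ⟨hBC, -, hB, hC⟩, rfl⟩
      exact ⟨B, hB, C, hC, hBC⟩

/-- In a minimal branching set no tree avoids a nonempty relatively open subset beyond a certain
depth: the points at which infinite avoidance is possible would form a smaller branching set. -/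
lemma exists_avoidingTree_eq_empty [T2Space Y] {R : Set (Y × Y × Y)} (hR : IsClosed R)
    {P U : Set Y} (hP : Minimal (fun Q ↦ IsClosed Q ∧ Q.Nonempty ∧ IsBranching R Q) P)
    (hU : IsOpen U) (hPU : (P ∩ U).Nonempty) : ∃ k, avoidingTree R P U k = ∅ := by
  by_contra! hne
  have hcl := isClosed_avoidingTree hR hP.prop.1 hU
  have hstep : ∀ k, avoidingTree R P U (k + 1) ⊆ avoidingTree R P U k := fun k A hA ↦ hA.1
  have hdir : Directed (· ⊇ ·) (avoidingTree R P U) :=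
    (antitone_nat_of_succ_le hstep).directed_ge
  have hne' := IsCompact.nonempty_iInter_of_sequence_nonempty_isCompact_isClosed _ hstep
    hne (hcl 0).isCompact hcl
  have hb : IsBranching R (⋂ k, avoidingTree R P U k) := fun A hA ↦
    exists_mem_iInter_of_directed hR hdir hcl fun k ↦ (mem_iInter.1 hA (k + 1)).2
  have hsub : ⋂ k, avoidingTree R P U k ⊆ P \ U := iInter_subset _ 0
  obtain ⟨A, hAP, hAU⟩ := hPU
  have hle := hP.le_of_le ⟨isClosed_iInter hcl, hne', hb⟩ (hsub.trans sdiff_subset)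
  exact (hsub (hle hAP)).2 hAU

end CompactSpaces

/-! ### The hyperspace of subcontinua -/

section Continua

variable {X : Type*} [MetricSpace X]

/-- Boundary bumping: if a continuum `A` contains points `p` and `q` at distance at least `r`,
then some subcontinuum of `A` contains `p`, lies in the ball of radius `r` about `p`, and
reaches its boundary. -/
lemma exists_subcontinuum_dist_eq {A : Set X} (hA : IsSubcontinuum A) {p q : X} (hp : p ∈ A)
    (hq : q ∈ A) {r : ℝ} (hr : 0 ≤ r) (hpq : r ≤ dist p q) :
    ∃ B ⊆ A, IsSubcontinuum B ∧ p ∈ B ∧ (∀ x ∈ B, dist p x ≤ r) ∧ ∃ x ∈ B, dist p x = r := by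
  set F : Set X := A ∩ {x | dist p x ≤ r} with hF
  have hFc : IsCompact F :=
    hA.1.inter_right (isClosed_le (continuous_const.dist continuous_id) continuous_const)
  have hpF : p ∈ F := ⟨hp, by simpa using hr⟩
  have : CompactSpace F := isCompact_iff_compactSpace.1 hFc
  set p' : F := ⟨p, hpF⟩
  have hBF : Subtype.val '' connectedComponent p' ⊆ F := by
    rintro _ ⟨y, -, rfl⟩; exact y.2
  refine ⟨Subtype.val '' connectedComponent p', hBF.trans inter_subset_left,
    ⟨isClosed_connectedComponent.isCompact.image continuous_subtype_val,
      isConnected_connectedComponent.image _ continuous_subtype_val.continuousOn⟩,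
    ⟨p', mem_connectedComponent, rfl⟩, fun x hx ↦ (hBF hx).2, ?_⟩
  by_contra! hcon
  -- Otherwise the component, hence a clopen subset of `F`, lies in the open ball.
  have hopen : IsOpen {y : F | dist p y < r} :=
    isOpen_lt (continuous_const.dist continuous_subtype_val) continuous_const
  have hsub : ⋂ s : {s : Set F // IsClopen s ∧ p' ∈ s}, s.1 ⊆ {y : F | dist p y < r} := by
    rw [← connectedComponent_eq_iInter_isClopen]
    intro y hy
    exact lt_of_le_of_ne y.2.2 (hcon y ⟨y, hy, rfl⟩)
  have : Nonempty {s : Set F // IsClopen s ∧ p' ∈ s} := ⟨⟨univ, isClopen_univ, mem_univ _⟩⟩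
  obtain ⟨⟨E, hE, hpE⟩, hEs⟩ := exists_subset_nhds_of_compactSpace
    (fun s t : {s : Set F // IsClopen s ∧ p' ∈ s} ↦
      ⟨⟨s.1 ∩ t.1, s.2.1.inter t.2.1, s.2.2, t.2.2⟩, inter_subset_left, inter_subset_right⟩)
    (fun s ↦ s.2.1.1) (fun y hy ↦ hopen.mem_nhds (hsub hy))
  -- Such a set is relatively clopen in `A`, contains `p` but not `q`.
  obtain ⟨V, hV, rfl⟩ := isOpen_induced_iff.1 hE.2
  have hclosed : IsClosed (Subtype.val '' (Subtype.val ⁻¹' V : Set F)) :=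
    (hE.1.isCompact.image continuous_subtype_val).isClosed
  have hballo : IsOpen {x : X | dist p x < r} :=
    isOpen_lt (continuous_const.dist continuous_id) continuous_const
  obtain ⟨z, hzA, ⟨hzV, hzr⟩, hz⟩ := hA.2.isPreconnected (V ∩ {x | dist p x < r})
    (Subtype.val '' (Subtype.val ⁻¹' V : Set F))ᶜ (hV.inter hballo) hclosed.isOpen_compl
    (fun x hx ↦ by
      by_cases h : x ∈ Subtype.val '' (Subtype.val ⁻¹' V : Set F)
      · obtain ⟨y, hy, rfl⟩ := h
        exact Or.inl ⟨hy, hEs hy⟩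
      · exact Or.inr h)
    ⟨p, hp, hpE, hEs hpE⟩
    ⟨q, hq, by
      rintro ⟨y, hy, rfl⟩
      exact (hEs hy : dist p y < r).not_ge hpq⟩
  exact hz ⟨⟨z, hzA, (show dist p z < r from hzr).le⟩, hzV, rfl⟩

lemma isClosed_setOf_coe_subset :
    IsClosed {p : NonemptyCompacts X × NonemptyCompacts X | (p.1 : Set X) ⊆ p.2} := by
  rw [← isOpen_compl_iff, isOpen_iff_forall_mem_open]
  rintro ⟨A, B⟩ hAB
  obtain ⟨x, hxA, hxB⟩ := not_subset.1 hAB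
  obtain ⟨U, V, hU, hV, hxU, hBV, hUV⟩ :=
    SeparatedNhds.of_isCompact_isCompact (isCompact_singleton (x := x)) B.isCompact (by simpa)
  refine ⟨{K : NonemptyCompacts X | ((K : Set X) ∩ U).Nonempty} ×ˢ
    {K : NonemptyCompacts X | (K : Set X) ⊆ V}, ?_,
    (NonemptyCompacts.isOpen_inter_nonempty_of_isOpen hU).prod
      (NonemptyCompacts.isOpen_subsets_of_isOpen hV), ⟨x, hxA, hxU rfl⟩, hBV⟩
  rintro ⟨K, L⟩ ⟨⟨y, hyK, hyU⟩, hL⟩ hKL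
  exact disjoint_left.1 hUV hyU (hL (hKL hyK))

lemma isClosed_setOf_isPreconnected :
    IsClosed {K : NonemptyCompacts X | IsPreconnected (K : Set X)} := by
  rw [← isOpen_compl_iff, isOpen_iff_forall_mem_open]
  intro K hK
  simp only [mem_compl_iff, mem_ofPred_eq, isPreconnected_closed_iff] at hK
  push Not at hK
  obtain ⟨t, t', ht, ht', hsub, hne, hne', hemp⟩ := hK
  obtain ⟨U, V, hU, hV, hKU, hKV, hUV⟩ := SeparatedNhds.of_isCompact_isCompact
    (K.isCompact.inter_right ht) (K.isCompact.inter_right ht') (by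
      rw [disjoint_iff_inter_eq_empty, ← inter_inter_distrib_left]
      exact hemp)
  refine ⟨{L : NonemptyCompacts X | (L : Set X) ⊆ U ∪ V} ∩
    ({L | ((L : Set X) ∩ U).Nonempty} ∩ {L | ((L : Set X) ∩ V).Nonempty}), ?_,
    (NonemptyCompacts.isOpen_subsets_of_isOpen (hU.union hV)).inter
      ((NonemptyCompacts.isOpen_inter_nonempty_of_isOpen hU).inter
        (NonemptyCompacts.isOpen_inter_nonempty_of_isOpen hV)), ?_, ?_, ?_⟩
  · rintro L ⟨hL, hLU, hLV⟩ hpre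
    obtain ⟨z, -, hzU, hzV⟩ := hpre U V hU hV hL hLU hLV
    exact disjoint_left.1 hUV hzU hzV
  · intro x hx
    exact (hsub hx).imp (fun h ↦ hKU ⟨hx, h⟩) (fun h ↦ hKV ⟨hx, h⟩)
  · exact hne.mono fun x hx ↦ ⟨hx.1, hKU hx⟩
  · exact hne'.mono fun x hx ↦ ⟨hx.1, hKV hx⟩

/-- The subcontinua of `X` of diameter at least `c`, as a part of the hyperspace of `X`. -/
def continuaOfDiam (X : Type*) [MetricSpace X] (c : ℝ) : Set (NonemptyCompacts X) :=
  {K | IsPreconnected (K : Set X) ∧ ∃ x ∈ K, ∃ y ∈ K, c ≤ dist x y}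

lemma isClosed_continuaOfDiam (c : ℝ) : IsClosed (continuaOfDiam X c) := by
  have hcl : IsClosed {z : X × X | c ≤ dist z.1 z.2} := isClosed_le continuous_const continuous_dist
  have hcont : Continuous fun K : NonemptyCompacts X ↦ K ×ˢ K :=
    NonemptyCompacts.continuous_prod.comp (continuous_id.prodMk continuous_id)
  convert isClosed_setOf_isPreconnected.inter
    ((NonemptyCompacts.isClosed_inter_nonempty_of_isClosed hcl).preimage hcont) using 2
  ext K
  refine and_congr_right fun _ ↦ ⟨?_, ?_⟩
  · rintro ⟨x, hx, y, hy, h⟩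
    exact ⟨(x, y), ⟨hx, hy⟩, h⟩
  · rintro ⟨⟨x, y⟩, ⟨hx, hy⟩, h⟩
    exact ⟨x, hx, y, hy, h⟩

/-- In a Suslinian space a nonempty closed family of nondegenerate subcontinua has a nonempty
relatively open part whose members pairwise intersect; otherwise a Cantor scheme would produce
uncountably many disjoint members. -/
lemma IsSuslinian.exists_isOpen_pairwise_inter [CompactSpace X] (hX : IsSuslinian X)
    {P : Set (NonemptyCompacts X)} (hP : IsClosed P) (hne : P.Nonempty)
    (hcont : ∀ K ∈ P, IsPreconnected (K : Set X) ∧ (K : Set X).Nontrivial) :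
    ∃ U, IsOpen U ∧ (P ∩ U).Nonempty ∧
      ∀ A ∈ P ∩ U, ∀ B ∈ P ∩ U, ¬ Disjoint (A : Set X) B := by
  by_contra! h
  obtain ⟨f, hfP, hf⟩ := exists_cantor_family hP hne
    NonemptyCompacts.isOpen_setOfPred_disjoint_coe h
  have hdisj : ∀ x y, x ≠ y → Disjoint (f x : Set X) (f y) := fun x y hxy ↦
    (hf x y hxy).elim id fun h ↦ Disjoint.symm h
  have hinj : Function.Injective fun x ↦ (f x : Set X) := by
    intro x y hxy
    by_contra hne
    have := hdisj x y hne
    simp only at hxy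
    rw [hxy, disjoint_self] at this
    exact (f y).nonempty.ne_empty this
  have hcount : (range fun x ↦ (f x : Set X)).Countable := by
    refine hX _ ?_ ?_
    · rintro _ ⟨x, rfl⟩
      exact ⟨⟨(f x).isCompact, (f x).nonempty, (hcont _ (hfP x)).1⟩, (hcont _ (hfP x)).2⟩
    · rintro _ ⟨x, rfl⟩ _ ⟨y, rfl⟩ hxy
      exact hdisj x y fun h ↦ hxy (by rw [h])
  have hcount' : Countable (ℕ → Bool) := by
    have := hcount.preimage_of_injOn hinj.injOn
    rw [preimage_range] at this
    exact countable_univ_iff.1 this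
  rw [← Cardinal.mk_le_aleph0_iff] at hcount'
  have hcard : Cardinal.mk (ℕ → Bool) = Cardinal.continuum := by simp
  exact (hcard ▸ hcount').not_gt Cardinal.aleph0_lt_continuum

end Continua

/-! ### Trees of continua for a group action -/

section Actions

variable {G X : Type*} [Group G] [MetricSpace X]

/-- The triples `(A, B, C)` such that `A` contains preimages of `B` and `C` under elements of the
finite set `F`, these preimages being at distance at least `η` from each other. -/
def splitting (φ : G →* (X ≃ₜ X)) (F : Finset G) (η : ℝ) :
    Set (NonemptyCompacts X × NonemptyCompacts X × NonemptyCompacts X) :=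
  {p | ∃ g ∈ F, ∃ h ∈ F, φ g ⁻¹' p.2.1 ⊆ p.1 ∧ φ h ⁻¹' p.2.2 ⊆ p.1 ∧
    ∀ x ∈ φ g ⁻¹' (p.2.1 : Set X), ∀ y ∈ φ h ⁻¹' (p.2.2 : Set X), η ≤ dist x y}

lemma isClosed_splitting (φ : G →* (X ≃ₜ X)) (F : Finset G) (η : ℝ) :
    IsClosed (splitting φ F η) := by
  have key : ∀ g h : G, IsClosed {p : NonemptyCompacts X × NonemptyCompacts X × NonemptyCompacts X |
      φ g ⁻¹' p.2.1 ⊆ p.1 ∧ φ h ⁻¹' p.2.2 ⊆ p.1 ∧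
      ∀ x ∈ φ g ⁻¹' (p.2.1 : Set X), ∀ y ∈ φ h ⁻¹' (p.2.2 : Set X), η ≤ dist x y} := by
    intro g h
    let m : G → NonemptyCompacts X → NonemptyCompacts X := fun g K ↦
      K.map (φ g).symm (φ g).symm.continuous
    have hm : ∀ g, Continuous (m g) := fun g ↦ (φ g).symm.continuous.nonemptyCompacts_map
    have hcoe : ∀ g (K : NonemptyCompacts X), φ g ⁻¹' (K : Set X) = m g K := fun g (K : NonemptyCompacts X) ↦
      ((φ g).image_symm ▸ rfl : φ g ⁻¹' (K : Set X) = (φ g).symm '' K)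
    have hcl : IsClosed {z : X × X | η ≤ dist z.1 z.2} :=
      isClosed_le continuous_const continuous_dist
    have h1 := isClosed_setOf_coe_subset.preimage
      (((hm g).comp (continuous_fst.comp continuous_snd)).prodMk continuous_fst :
        Continuous fun p : NonemptyCompacts X × NonemptyCompacts X × NonemptyCompacts X ↦
          (m g p.2.1, p.1))
    have h2 := isClosed_setOf_coe_subset.preimage
      (((hm h).comp (continuous_snd.comp continuous_snd)).prodMk continuous_fst :
        Continuous fun p : NonemptyCompacts X × NonemptyCompacts X × NonemptyCompacts X ↦
          (m h p.2.2, p.1))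
    have h3 := (NonemptyCompacts.isClosed_subsets_of_isClosed hcl).preimage
      (NonemptyCompacts.continuous_prod.comp
        (((hm g).comp (continuous_fst.comp continuous_snd)).prodMk
          ((hm h).comp (continuous_snd.comp continuous_snd))) :
        Continuous fun p : NonemptyCompacts X × NonemptyCompacts X × NonemptyCompacts X ↦
          m g p.2.1 ×ˢ m h p.2.2)
    convert h1.inter (h2.inter h3) using 1
    ext p
    simp only [hcoe]
    refine and_congr Iff.rfl (and_congr Iff.rfl ?_)
    constructor
    · rintro H ⟨x, y⟩ ⟨hx, hy⟩
      exact H x hx y hy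
    · intro H x hx y hy
      exact H (show (x, y) ∈ _ from ⟨hx, hy⟩)
  have : splitting φ F η = ⋃ g ∈ F, ⋃ h ∈ F,
      {p : NonemptyCompacts X × NonemptyCompacts X × NonemptyCompacts X |
      φ g ⁻¹' p.2.1 ⊆ p.1 ∧ φ h ⁻¹' p.2.2 ⊆ p.1 ∧
      ∀ x ∈ φ g ⁻¹' (p.2.1 : Set X), ∀ y ∈ φ h ⁻¹' (p.2.2 : Set X), η ≤ dist x y} := by
    ext p
    simp only [splitting, mem_ofPred_eq, mem_iUnion, exists_prop]
  rw [this]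
  exact isClosed_biUnion_finset fun g _ ↦ isClosed_biUnion_finset fun h _ ↦ key g h

/-- Expansiveness is witnessed on points at distance at least `ε` by finitely many group
elements. -/
lemma exists_finset_forall_lt_dist [CompactSpace X] {φ : G →* (X ≃ₜ X)} {c : ℝ}
    (h : ∀ x y : X, x ≠ y → ∃ g : G, c < dist (φ g x) (φ g y)) {ε : ℝ} (hε : 0 < ε) :
    ∃ F : Finset G, ∀ x y : X, ε ≤ dist x y → ∃ g ∈ F, c < dist (φ g x) (φ g y) := by
  have hcomp : IsCompact {z : X × X | ε ≤ dist z.1 z.2} :=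
    (isClosed_le continuous_const continuous_dist).isCompact
  obtain ⟨F, hF⟩ := hcomp.elim_finite_subcover
    (fun g : G ↦ {z : X × X | c < dist (φ g z.1) (φ g z.2)})
    (fun g ↦ isOpen_lt continuous_const
      (((φ g).continuous.comp continuous_fst).dist ((φ g).continuous.comp continuous_snd)))
    (fun z hz ↦ by
      obtain ⟨g, hg⟩ := h z.1 z.2 (dist_pos.1 (hε.trans_le hz))
      exact mem_iUnion.2 ⟨g, hg⟩)
  refine ⟨F, fun x y hxy ↦ ?_⟩
  have := hF (show (x, y) ∈ _ from hxy)
  simpa using this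

/-- Inside a continuum of diameter at least `c` there are two continua of diameter at least
`c / 3` at distance at least `c / 3`; elements of `F` expand each to diameter at least `c`. -/
lemma isBranching_continuaOfDiam {φ : G →* (X ≃ₜ X)} {c : ℝ} (hc : 0 < c)
    {F : Finset G} (hF : ∀ x y : X, c / 3 ≤ dist x y → ∃ g ∈ F, c < dist (φ g x) (φ g y)) :
    IsBranching (splitting φ F (c / 3)) (continuaOfDiam X c) := by
  rintro A ⟨hA, p, hp, q, hq, hpq⟩
  have hAc : IsSubcontinuum (A : Set X) := ⟨A.isCompact, A.nonempty, hA⟩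
  have hc3 : 0 ≤ c / 3 := by positivity
  have expand : ∀ B : Set X, IsSubcontinuum B → ∀ x ∈ B, ∀ y ∈ B, dist x y = c / 3 →
      ∃ g ∈ F, ∃ K ∈ continuaOfDiam X c, φ g ⁻¹' (K : Set X) = B := by
    intro B hB x hx y hy hxy
    obtain ⟨g, hg, hlt⟩ := hF x y hxy.ge
    refine ⟨g, hg, ⟨⟨φ g '' B, hB.1.image (φ g).continuous⟩, hB.2.nonempty.image _⟩,
      ⟨hB.2.isPreconnected.image _ (φ g).continuous.continuousOn,
        φ g x, mem_image_of_mem _ hx, φ g y, mem_image_of_mem _ hy, hlt.le⟩, ?_⟩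
    exact preimage_image_eq B (φ g).injective
  obtain ⟨B, hBA, hB, hpB, hBr, x, hxB, hx⟩ :=
    exists_subcontinuum_dist_eq hAc hp hq hc3 (by linarith)
  obtain ⟨C, hCA, hC, hqC, hCr, y, hyC, hy⟩ :=
    exists_subcontinuum_dist_eq hAc hq hp hc3 (by rw [dist_comm]; linarith)
  obtain ⟨g, hg, K, hK, rfl⟩ := expand B hB p hpB x hxB hx
  obtain ⟨h, hh, L, hL, rfl⟩ := expand C hC q hqC y hyC hy
  refine ⟨K, hK, L, hL, g, hg, h, hh, hBA, hCA, fun u hu v hv ↦ ?_⟩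
  have h1 := hBr u hu
  have h2 := hCr v hv
  have h3 := dist_triangle4 p u v q
  rw [dist_comm v q] at h3
  linarith

lemma preimage_mul_subset {φ : G →* (X ≃ₜ X)} {g h : G} {A B C : Set X} (hB : φ h ⁻¹' B ⊆ A)
    (hC : φ g ⁻¹' C ⊆ B) : φ (g * h) ⁻¹' C ⊆ A := by
  rw [map_mul]
  exact (preimage_mono (f := φ h) hC).trans hB

open scoped Pointwise

variable [DecidableEq G]

/-- From a point at which trees of depth `k` cannot avoid `U`, some member of `U` is reached
within `k` steps. -/
lemma exists_mem_pow_preimage_subset {φ : G →* (X ≃ₜ X)} {F : Finset G} (h1 : 1 ∈ F) {η : ℝ}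
    {P U : Set (NonemptyCompacts X)} (hP : IsBranching (splitting φ F η) P) (k : ℕ) :
    ∀ A ∈ P, A ∉ avoidingTree (splitting φ F η) P U k →
      ∃ B ∈ P ∩ U, ∃ g ∈ F ^ k, φ g ⁻¹' (B : Set X) ⊆ A := by
  induction k with
  | zero =>
    intro A hA hAU
    have hAU' : A ∈ U := by
      by_contra h
      exact hAU ⟨hA, h⟩
    exact ⟨A, ⟨hA, hAU'⟩, 1, by simp, by rw [map_one]; exact subset_rfl⟩
  | succ k ih =>
    intro A hA hAU
    by_cases hAk : A ∈ avoidingTree (splitting φ F η) P U k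
    · obtain ⟨B, hB, C, hC, hBC⟩ := hP A hA
      have hor : B ∉ avoidingTree (splitting φ F η) P U k ∨
          C ∉ avoidingTree (splitting φ F η) P U k := by
        by_contra! h
        exact hAU ⟨hAk, B, h.1, C, h.2, hBC⟩
      obtain ⟨g, hg, h, hh, hgB, hhC, -⟩ := hBC
      rcases hor with hn | hn
      · obtain ⟨D, hD, u, hu, huD⟩ := ih B hB hn
        exact ⟨D, hD, u * g, pow_succ F k ▸ Finset.mul_mem_mul hu hg, preimage_mul_subset hgB huD⟩
      · obtain ⟨D, hD, u, hu, huD⟩ := ih C hC hn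
        exact ⟨D, hD, u * h, pow_succ F k ▸ Finset.mul_mem_mul hu hh, preimage_mul_subset hhC huD⟩
    · obtain ⟨B, hB, g, hg, hgB⟩ := ih A hA hAk
      exact ⟨B, hB, g, Finset.pow_subset_pow_right h1 k.le_succ hg, hgB⟩

/-- Following a binary tree for `j` steps and then each of its branches into `U` produces `2 ^ j`
pairwise disjoint subcontinua, each taken to a member of `U` by a word of length `j + k`. -/
lemma exists_disjoint_preimages {φ : G →* (X ≃ₜ X)} {F : Finset G} (h1 : 1 ∈ F) {η : ℝ}
    (hη : 0 < η) {P U : Set (NonemptyCompacts X)} (hP : IsBranching (splitting φ F η) P) {k : ℕ}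
    (hk : avoidingTree (splitting φ F η) P U k = ∅) (j : ℕ) :
    ∀ A ∈ P, ∃ (ι : Type) (_ : Fintype ι) (B : ι → NonemptyCompacts X) (g : ι → G),
      Fintype.card ι = 2 ^ j ∧
      (∀ i, B i ∈ P ∩ U ∧ g i ∈ F ^ (j + k) ∧ φ (g i) ⁻¹' (B i : Set X) ⊆ A) ∧
      ∀ i i', i ≠ i' → Disjoint (φ (g i) ⁻¹' (B i : Set X)) (φ (g i') ⁻¹' (B i' : Set X)) := by
  induction j with
  | zero =>
    intro A hA
    obtain ⟨B, hB, g, hg, hgB⟩ :=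
      exists_mem_pow_preimage_subset (U := U) h1 hP k A hA (by rw [hk]; exact notMem_empty A)
    exact ⟨Unit, inferInstance, fun _ ↦ B, fun _ ↦ g, by simp,
      fun _ ↦ ⟨hB, by simpa using hg, hgB⟩, fun i i' h ↦ absurd (Subsingleton.elim i i') h⟩
  | succ j ih =>
    intro A hA
    obtain ⟨B, hB, C, hC, u, hu, v, hv, huB, hvC, hsep⟩ := hP A hA
    obtain ⟨ι, _, K, g, hcard, hK, hKd⟩ := ih B hB
    obtain ⟨ι', _, L, h, hcard', hL, hLd⟩ := ih C hC
    have hpre : ∀ (a b : G) (S : Set X), φ (a * b) ⁻¹' S = φ b ⁻¹' (φ a ⁻¹' S) := by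
      intro a b S
      rw [map_mul]; rfl
    have hcross : ∀ i i', Disjoint (φ (g i * u) ⁻¹' (K i : Set X))
        (φ (h i' * v) ⁻¹' (L i' : Set X)) := by
      intro i i'
      rw [disjoint_left]
      intro x hx hx'
      rw [hpre] at hx hx'
      have := hsep x ((hK i).2.2 hx) x ((hL i').2.2 hx')
      rw [dist_self] at this
      exact this.not_gt hη
    have hexp : j + 1 + k = j + k + 1 := by ring
    refine ⟨ι ⊕ ι', inferInstance, Sum.elim K L,
      Sum.elim (fun i ↦ g i * u) (fun i ↦ h i * v), ?_, ?_, ?_⟩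
    · rw [Fintype.card_sum, hcard, hcard', pow_succ, mul_two]
    · rintro (i | i)
      · refine ⟨(hK i).1, ?_, preimage_mul_subset huB (hK i).2.2⟩
        rw [hexp, pow_succ]
        exact Finset.mul_mem_mul (hK i).2.1 hu
      · refine ⟨(hL i).1, ?_, preimage_mul_subset hvC (hL i).2.2⟩
        rw [hexp, pow_succ]
        exact Finset.mul_mem_mul (hL i).2.1 hv
    · rintro (i | i) (i' | i') hii'
      · simp only [Sum.elim_inl, hpre]
        exact (hKd i i' fun h ↦ hii' (h ▸ rfl)).preimage _
      · exact hcross i i'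
      · exact (hcross i' i).symm
      · simp only [Sum.elim_inr, hpre]
        exact (hLd i i' fun h ↦ hii' (h ▸ rfl)).preimage _

end Actions

/-- A finitely generated nilpotent group admits no expansive continuous action on a
nondegenerate Suslinian continuum. -/
theorem corollary1p3 {G : Type*} [Group G] [Group.FG G] [Group.IsNilpotent G]
    {X : Type*} [MetricSpace X] [CompactSpace X] [ConnectedSpace X] [Nontrivial X]
    (hX : IsSuslinian X) (φ : G →* (X ≃ₜ X)) :
    ¬ IsExpansive φ := by
  classical
  rintro ⟨c, hc, hexp⟩
  replace hexp : ∀ x y : X, x ≠ y → ∃ g : G, c < dist (φ g x) (φ g y) := fun x y hxy ↦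
    exists_lt_of_lt_ciSup (hexp x y hxy)
  have hc3 : 0 < c / 3 := by positivity
  obtain ⟨F₀, hF₀⟩ := exists_finset_forall_lt_dist hexp hc3
  set F : Finset G := insert 1 F₀
  have hF : ∀ x y : X, c / 3 ≤ dist x y → ∃ g ∈ F, c < dist (φ g x) (φ g y) := fun x y hxy ↦
    (hF₀ x y hxy).imp fun g hg ↦ ⟨Finset.mem_insert_of_mem hg.1, hg.2⟩
  have h1 : (1 : G) ∈ F := Finset.mem_insert_self _ _
  have hne : (continuaOfDiam X c).Nonempty := by
    obtain ⟨x, y, hxy⟩ := exists_pair_ne X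
    obtain ⟨g, hg⟩ := hexp x y hxy
    exact ⟨⟨⟨univ, isCompact_univ⟩, univ_nonempty⟩, isPreconnected_univ,
      φ g x, mem_univ _, φ g y, mem_univ _, hg.le⟩
  have hR := isClosed_splitting φ F (c / 3)
  obtain ⟨P, hPsub, hP⟩ := exists_minimal_isBranching hR (isClosed_continuaOfDiam c) hne
    (isBranching_continuaOfDiam hc hF)
  have hPb := hP.prop.2.2
  obtain ⟨U, hU, hPU, hlinked⟩ := hX.exists_isOpen_pairwise_inter hP.prop.1 hP.prop.2.1
    fun K hK ↦ by
      obtain ⟨hK, x, hx, y, hy, hxy⟩ := hPsub hK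
      exact ⟨hK, x, hx, y, hy, dist_pos.1 (hc.trans_le hxy)⟩
  obtain ⟨k, hk⟩ := exists_avoidingTree_eq_empty hR hP hU hPU
  obtain ⟨j, hj⟩ := (hasPolynomialGrowth_of_isNilpotent F).exists_card_pow_lt_two_pow k
  obtain ⟨A, hA⟩ := hP.prop.2.1
  obtain ⟨ι, _, B, g, hcard, hB, hdisj⟩ := exists_disjoint_preimages h1 hc3 hPb hk j A hA
  -- There are more disjoint continua than group elements to bring them into `U`.
  obtain ⟨i, -, i', -, hii', hg⟩ := Finset.exists_ne_map_eq_of_card_lt_of_maps_to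
    (s := Finset.univ) (f := g) (hj.trans_eq (hcard.symm.trans Finset.card_univ.symm))
    fun i _ ↦ (hB i).2.1
  have hd := hdisj i i' hii'
  rw [← hg, disjoint_preimage_iff (φ (g i)).surjective] at hd
  exact hlinked _ (hB i).1 _ (hB i').1 hd
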